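/- Work in the real projective plane, i.e. the Euclidean plane completed by its line at infinity. Let $ABC$ be a triangle. A *cevian* is a line joining a vertex to a point (its *foot*) of the opposite side line different from the other two vertices. Let $AA_1, BB_1, CC_1$ and $AA_2, BB_2, CC_2$ be two triples of cevians with feet $A_i\in BC$, $B_i\in CA$, $C_i\in AB$ and $A_1\ne A_2$, $B_1\ne B_2$, $C_1\ne C_2$. For $i=1,2$ put $X_i=BB_i\cap CC_i$, $Y_i=AA_i\cap CC_i$, $Z_i=AA_i\cap BB_i$, and let $U_1=BB_1\cap CC_2$, $V_1=CC_1\cap AA_2$, $W_1=AA_1\cap BB_2$. Consider the conditions 1. $A_1,A_2,B_1,B_2,C_1,C_2$ lie on a single conic; 2. $X_1,X_2,Y_1,Y_2,Z_1,Z_2$ lie on a single conic; 3. the six lines $AA_1,AA_2,BB_1,BB_2,CC_1,CC_2$ touch a single conic; 4. the lines $AU_1$, $BV_1$, $CW_1$ intersect in a single point. Conics may be degenerate: in (1) and (2) a conic is the zero set of any nonzero ternary real quadratic form; in (3) it is either a nondegenerate conic or a pair of points $P,Q$ (possibly equal), a line being said to touch the latter if it passes through $P$ or through $Q$. Then (1),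 (3) and (4) are equivalent, and they imply (2). If moreover the two triples of cevians are both concurrent or both non-concurrent ($X_1=Y_1=Z_1$ if and only if $X_2=Y_2=Z_2$), then all four conditions (1)--(4) are equivalent. -/

import Mathlib

open scoped LinearAlgebra.Projectivization

namespace CevianConics

/-- The real projective plane: the Euclidean plane together with its line at infinity. -/
abbrev Plane : Type := ℙ ℝ (Fin 3 → ℝ)

/-- The line joining the points `P` and `Q` (only used for `P ≠ Q`). -/
noncomputable def line (P Q : Plane) : Projectivization.Subspace ℝ (Fin 3 → ℝ) :=
  Projectivization.Subspace.span {P, Q}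

/-- The point `P` lies on the conic with equation `q = 0`. -/
def OnConic (q : QuadraticForm ℝ (Fin 3 → ℝ)) (P : Plane) : Prop :=
  q P.rep = 0

/-- The condition `OnConic` does not depend on the choice of homogeneous coordinates. -/
theorem onConic_mk (q : QuadraticForm ℝ (Fin 3 → ℝ)) (v : Fin 3 → ℝ) (hv : v ≠ 0) :
    OnConic q (Projectivization.mk ℝ v hv) ↔ q v = 0 := by
  obtain ⟨a, ha⟩ := Projectivization.exists_smul_eq_mk_rep ℝ v hv
  unfold OnConic
  rw [← ha, Units.smul_def, QuadraticMap.map_smul]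
  simp

/-- The points of `S` lie on a single conic (degenerate conics, given by an arbitrary nonzero
ternary quadratic form, are allowed). -/
def LieOnOneConic (S : Set Plane) : Prop :=
  ∃ q : QuadraticForm ℝ (Fin 3 → ℝ), q ≠ 0 ∧ ∀ P ∈ S, OnConic q P

/-- The line `l` is tangent to the (nondegenerate) conic `q = 0` at one of its points `P`:
`P` lies on `l` and on the conic, and `l` is contained in the tangent line `polar q P = 0`. -/
def IsTangent (q : QuadraticForm ℝ (Fin 3 → ℝ))
    (l : Projectivization.Subspace ℝ (Fin 3 → ℝ)) : Prop :=
  ∃ P ∈ l, OnConic q P ∧ ∀ R ∈ l, QuadraticMap.polar q P.rep R.rep = 0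

/-- The lines of `L` touch a single conic. Either this is a nondegenerate conic, to which all
lines are tangent, or it is a degenerate conic in the sense of line geometry, that is a pair of
points `P`, `Q` whose "tangents" are the lines through `P` and the lines through `Q`. -/
def TouchOneConic (L : Set (Projectivization.Subspace ℝ (Fin 3 → ℝ))) : Prop :=
  (∃ q : QuadraticForm ℝ (Fin 3 → ℝ), q.Nondegenerate ∧ ∀ l ∈ L, IsTangent q l) ∨
  (∃ P Q : Plane, ∀ l ∈ L, P ∈ l ∨ Q ∈ l)

/-- `P` is the point of intersection of the (distinct) lines `l` and `m`. -/
def IsMeet (P : Plane) (l m : Projectivization.Subspace ℝ (Fin 3 → ℝ)) : Prop :=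
  P ∈ l ∧ P ∈ m

/-- `A₁` is the foot on the line `BC` of a cevian from the opposite vertex; a cevian is not a
side, so its foot is not a vertex. -/
def IsFoot (A₁ B C : Plane) : Prop :=
  A₁ ∈ line B C ∧ A₁ ≠ B ∧ A₁ ≠ C

end CevianConics

open CevianConics

/-! In homogeneous coordinates with `A`, `B`, `C` as coordinate points, the feet are `(0 : 1 : pᵢ)`,
`(qᵢ : 0 : 1)`, `(1 : rᵢ : 0)`. Let `D = p₁p₂q₁q₂r₁r₂`. The conic through the feet, the conic
touching the cevians and the concurrency of `AU₁`, `BV₁`, `CW₁` are each equivalent to `D = 1`: by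
Carnot's theorem (`carnot`), by its dual (`touchOneConic_iff`) and by Ceva's theorem for slopes
`q₁r₂`, `p₂r₁`, `q₂p₁` (`existsUnique_mem_iff`).

For the six vertices, fix the square coefficients of a form. Each triple then suggests mixed
coefficients that make the form vanish at its three vertices, and the two suggestions agree exactly
on the kernel of `cevianMatrix`, whose determinant is `(D - 1)(p₁ - p₂)(q₁ - q₂)(r₁ - r₂) / D`. So
`D = 1` yields a conic. Conversely, a non-concurrent triple forces its mixed coefficients, so two
such triples on a conic give `D = 1`; if both triples are concurrent, `D` is the product of two Ceva
products, each equal to 1. -/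

namespace CevianConics

/-! ### Ternary quadratic forms -/

/-- The form `α x² + β y² + γ z² + f yz + g zx + h xy`. -/
noncomputable def ternary (α β γ f g h : ℝ) : QuadraticForm ℝ (Fin 3 → ℝ) :=
  α • QuadraticMap.linMulLin (LinearMap.proj 0) (LinearMap.proj 0) +
  β • QuadraticMap.linMulLin (LinearMap.proj 1) (LinearMap.proj 1) +
  γ • QuadraticMap.linMulLin (LinearMap.proj 2) (LinearMap.proj 2) +
  f • QuadraticMap.linMulLin (LinearMap.proj 1) (LinearMap.proj 2) +
  g • QuadraticMap.linMulLin (LinearMap.proj 2) (LinearMap.proj 0) +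
  h • QuadraticMap.linMulLin (LinearMap.proj 0) (LinearMap.proj 1)

theorem ternary_apply (α β γ f g h : ℝ) (v : Fin 3 → ℝ) :
    ternary α β γ f g h v = α * v 0 ^ 2 + β * v 1 ^ 2 + γ * v 2 ^ 2 + f * (v 1 * v 2) +
      g * (v 2 * v 0) + h * (v 0 * v 1) := by
  simp [ternary]
  ring

theorem map_smul_add_smul_add_smul (q : QuadraticForm ℝ (Fin 3 → ℝ)) (x y z : ℝ)
    (a b c : Fin 3 → ℝ) :
    q (x • a + y • b + z • c) = q a * x ^ 2 + q b * y ^ 2 + q c * z ^ 2 +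
      QuadraticMap.polar q b c * (y * z) + QuadraticMap.polar q c a * (z * x) +
      QuadraticMap.polar q a b * (x * y) := by
  rw [QuadraticMap.map_add q (x • a + y • b), QuadraticMap.map_add q (x • a),
    QuadraticMap.polar_add_left, QuadraticMap.polar_comm q c a]
  simp only [QuadraticMap.map_smul, QuadraticMap.polar_smul_left, QuadraticMap.polar_smul_right,
    smul_eq_mul]
  ring

theorem exists_eq_ternary (q : QuadraticForm ℝ (Fin 3 → ℝ)) :
    ∃ α β γ f g h : ℝ, q = ternary α β γ f g h := by
  refine ⟨q ![1, 0, 0], q ![0, 1, 0], q ![0, 0, 1], QuadraticMap.polar q ![0, 1, 0] ![0, 0, 1],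
    QuadraticMap.polar q ![0, 0, 1] ![1, 0, 0], QuadraticMap.polar q ![1, 0, 0] ![0, 1, 0], ?_⟩
  ext v
  have hv : v = v 0 • ![1, 0, 0] + v 1 • ![0, 1, 0] + v 2 • ![0, 0, 1] := by
    ext i; fin_cases i <;> simp
  rw [ternary_apply]
  conv_lhs => rw [hv]
  exact map_smul_add_smul_add_smul q _ _ _ _ _ _

theorem ternary_zero : ternary 0 0 0 0 0 0 = 0 := by
  ext v; simp [ternary_apply]

theorem polar_ternary (α β γ f g h : ℝ) (v w : Fin 3 → ℝ) :
    QuadraticMap.polar (ternary α β γ f g h) v w =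
      (2 * α * v 0 + h * v 1 + g * v 2) * w 0 + (h * v 0 + 2 * β * v 1 + f * v 2) * w 1 +
      (g * v 0 + f * v 1 + 2 * γ * v 2) * w 2 := by
  simp only [QuadraticMap.polar, ternary_apply, Pi.add_apply]
  ring

/-- The conic `q = 0` is nondegenerate if no vector is orthogonal to everything. -/
theorem nondegenerate_of_polar {q : QuadraticForm ℝ (Fin 3 → ℝ)}
    (hq : ∀ v, (∀ w, QuadraticMap.polar q v w = 0) → v = 0) : q.Nondegenerate := by
  let : Invertible (2 : ℝ) := invertibleOfNonzero two_ne_zero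
  rw [QuadraticMap.nondegenerate_iff_radical_eq_bot, QuadraticMap.radical_eq_ker_polarBilin,
    eq_bot_iff]
  intro v hv
  rw [LinearMap.mem_ker] at hv
  exact hq v fun w => by simpa using LinearMap.congr_fun hv w

theorem eq_zero_of_polar {q : QuadraticForm ℝ (Fin 3 → ℝ)} (hq : q.Nondegenerate)
    {v : Fin 3 → ℝ} (hv : ∀ w, QuadraticMap.polar q v w = 0) : v = 0 := by
  let : Invertible (2 : ℝ) := invertibleOfNonzero two_ne_zero
  have h := hq.radical_eq_bot
  rw [QuadraticMap.radical_eq_ker_polarBilin, eq_bot_iff] at h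
  exact h (LinearMap.mem_ker.2 (LinearMap.ext fun w => by simpa using hv w))

theorem ternary_nondegenerate {α β γ f g h : ℝ}
    (hd : 4 * α * β * γ - α * f ^ 2 - β * g ^ 2 - γ * h ^ 2 + f * g * h ≠ 0) :
    (ternary α β γ f g h).Nondegenerate := by
  refine nondegenerate_of_polar fun v hv => ?_
  have h0 := hv ![1, 0, 0]
  have h1 := hv ![0, 1, 0]
  have h2 := hv ![0, 0, 1]
  simp only [polar_ternary, Matrix.cons_val, mul_one, mul_zero, add_zero, zero_add] at h0 h1 h2
  ext i
  apply mul_left_cancel₀ hd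
  fin_cases i <;> simp only [Pi.zero_apply, mul_zero, Fin.zero_eta, Fin.mk_one, Fin.reduceFinMk]
  -- Cramer's rule: the multipliers are half the cofactors of the matrix of the polar form, whose
  -- determinant is twice the expression in `hd`.
  · linear_combination (2 * β * γ - f ^ 2 / 2) * h0 + (f * g / 2 - γ * h) * h1 +
      (f * h / 2 - β * g) * h2
  · linear_combination (f * g / 2 - γ * h) * h0 + (2 * α * γ - g ^ 2 / 2) * h1 +
      (g * h / 2 - α * f) * h2
  · linear_combination (f * h / 2 - β * g) * h0 + (g * h / 2 - α * f) * h1 +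
      (2 * α * β - h ^ 2 / 2) * h2

/-- A nondegenerate quadratic form identifies the space with its dual. -/
theorem exists_polar_equiv {q : QuadraticForm ℝ (Fin 3 → ℝ)} (hq : q.Nondegenerate) :
    ∃ T : (Fin 3 → ℝ) ≃ₗ[ℝ] (Fin 3 → ℝ), ∀ x y, QuadraticMap.polar q x y = T x ⬝ᵥ y := by
  let T : (Fin 3 → ℝ) →ₗ[ℝ] (Fin 3 → ℝ) :=
    LinearMap.pi fun i => q.polarBilin.flip (Pi.single i 1)
  have hT : ∀ x y, QuadraticMap.polar q x y = T x ⬝ᵥ y := by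
    intro x y
    have hy : y = y 0 • Pi.single 0 1 + y 1 • Pi.single 1 1 + y 2 • Pi.single 2 1 := by
      ext i; fin_cases i <;> simp
    conv_lhs => rw [hy]
    simp only [QuadraticMap.polar_add_right, QuadraticMap.polar_smul_right, smul_eq_mul,
      dotProduct, Fin.sum_univ_three, T, LinearMap.pi_apply, LinearMap.flip_apply,
      QuadraticMap.polarBilin_apply_apply]
    ring
  have hinj : Function.Injective T := by
    rw [← LinearMap.ker_eq_bot, eq_bot_iff]
    intro v hv
    rw [LinearMap.mem_ker] at hv
    exact eq_zero_of_polar hq fun w => by rw [hT, hv, zero_dotProduct]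
  exact ⟨LinearEquiv.ofInjectiveEndo T hinj, hT⟩

/-! ### Carnot's theorem and its analogue for the triangles cut out by the cevians -/

/-- **Carnot's theorem** for conics meeting each side of the coordinate triangle in two points
other than the vertices. -/
theorem carnot {p₁ p₂ q₁ q₂ r₁ r₂ : ℝ} (hp : p₁ ≠ p₂) (hq : q₁ ≠ q₂) (hr : r₁ ≠ r₂) :
    (∃ F : QuadraticForm ℝ (Fin 3 → ℝ), F ≠ 0 ∧ F ![0, 1, p₁] = 0 ∧ F ![0, 1, p₂] = 0 ∧
      F ![q₁, 0, 1] = 0 ∧ F ![q₂, 0, 1] = 0 ∧ F ![1, r₁, 0] = 0 ∧ F ![1, r₂, 0] = 0) ↔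
    p₁ * p₂ * q₁ * q₂ * r₁ * r₂ = 1 := by
  constructor
  · rintro ⟨F, hF, a₁, a₂, b₁, b₂, c₁, c₂⟩
    obtain ⟨α, β, γ, f, g, h, rfl⟩ := exists_eq_ternary F
    simp only [ternary_apply, Matrix.cons_val] at a₁ a₂ b₁ b₂ c₁ c₂
    -- Vieta on each side: restricted to `x = 0` the form is `γp² + fp + β` with roots `p₁ ≠ p₂`,
    -- and similarly on the other sides. Going round the triangle returns `α` multiplied by `D`.
    have f1 : f = -γ * (p₁ + p₂) := mul_left_cancel₀ (sub_ne_zero.2 hp) (by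
      linear_combination a₁ - a₂)
    have f2 : β = γ * (p₁ * p₂) := by subst f1; linear_combination a₁
    have g1 : g = -α * (q₁ + q₂) := mul_left_cancel₀ (sub_ne_zero.2 hq) (by
      linear_combination b₁ - b₂)
    have g2 : γ = α * (q₁ * q₂) := by subst g1; linear_combination b₁
    have h1 : h = -β * (r₁ + r₂) := mul_left_cancel₀ (sub_ne_zero.2 hr) (by
      linear_combination c₁ - c₂)
    have h2 : α = β * (r₁ * r₂) := by subst h1; linear_combination c₁
    have hα : α ≠ 0 := by
      rintro rfl
      rw [zero_mul] at g2
      subst g2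
      rw [zero_mul] at f2
      subst f2
      apply hF
      rw [f1, g1, h1]
      simp [ternary_zero]
    apply mul_left_cancel₀ hα
    rw [g2] at f2
    rw [f2] at h2
    linear_combination -h2
  · intro hD
    -- Vieta's formulas with `α = 1`; only the closing relation on the third side needs `hD`.
    refine ⟨ternary 1 (q₁ * q₂ * p₁ * p₂) (q₁ * q₂) (-(q₁ * q₂) * (p₁ + p₂)) (-(q₁ + q₂))
      (-(q₁ * q₂ * p₁ * p₂) * (r₁ + r₂)), ?_, ?_⟩
    · intro h
      have := congrArg (fun F : QuadraticForm ℝ (Fin 3 → ℝ) => F ![1, 0, 0]) h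
      simp [ternary_apply] at this
    · simp only [ternary_apply, Matrix.cons_val]
      refine ⟨by ring, by ring, by ring, by ring, ?_, ?_⟩ <;> linear_combination -hD

/-- The linear system for the `x²`, `y²` and `z²` coefficients of a conic through the vertices of
the triangles cut out by two triples of cevians. -/
noncomputable def cevianMatrix (p₁ p₂ q₁ q₂ r₁ r₂ : ℝ) : Matrix (Fin 3) (Fin 3) ℝ :=
  !![1 / r₁ - 1 / r₂, r₁ - r₂, -(p₁ / q₁ - p₂ / q₂);
     -(q₁ / r₁ - q₂ / r₂), 1 / p₁ - 1 / p₂, p₁ - p₂;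
     q₁ - q₂, -(r₁ / p₁ - r₂ / p₂), 1 / q₁ - 1 / q₂]

theorem det_cevianMatrix {p₁ p₂ q₁ q₂ r₁ r₂ : ℝ} (hp₁ : p₁ ≠ 0) (hp₂ : p₂ ≠ 0)
    (hq₁ : q₁ ≠ 0) (hq₂ : q₂ ≠ 0) (hr₁ : r₁ ≠ 0) (hr₂ : r₂ ≠ 0) :
    (cevianMatrix p₁ p₂ q₁ q₂ r₁ r₂).det * (p₁ * p₂ * q₁ * q₂ * r₁ * r₂) =
      (p₁ * p₂ * q₁ * q₂ * r₁ * r₂ - 1) * ((p₁ - p₂) * (q₁ - q₂) * (r₁ - r₂)) := by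
  simp only [cevianMatrix, Matrix.det_fin_three, Matrix.of_apply, Matrix.cons_val]
  field_simp
  ring

/-- The analogue of Carnot's theorem for the vertices of the two triangles cut out by two triples
of cevians. -/
theorem exists_form_cevian_triangles {p₁ p₂ q₁ q₂ r₁ r₂ : ℝ} (hp₁ : p₁ ≠ 0) (hp₂ : p₂ ≠ 0)
    (hq₁ : q₁ ≠ 0) (hq₂ : q₂ ≠ 0) (hr₁ : r₁ ≠ 0) (hr₂ : r₂ ≠ 0)
    (hD : p₁ * p₂ * q₁ * q₂ * r₁ * r₂ = 1) :
    ∃ F : QuadraticForm ℝ (Fin 3 → ℝ), F ≠ 0 ∧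
      F ![q₁, q₁ * r₁, 1] = 0 ∧ F ![q₂, q₂ * r₂, 1] = 0 ∧
      F ![1, r₁, p₁ * r₁] = 0 ∧ F ![1, r₂, p₂ * r₂] = 0 ∧
      F ![q₁ * p₁, 1, p₁] = 0 ∧ F ![q₂ * p₂, 1, p₂] = 0 := by
  have hM : (cevianMatrix p₁ p₂ q₁ q₂ r₁ r₂).det = 0 := by
    have := det_cevianMatrix hp₁ hp₂ hq₁ hq₂ hr₁ hr₂
    rw [hD, mul_one] at this
    rw [this]; ring
  obtain ⟨v, hv, hMv⟩ := Matrix.exists_mulVec_eq_zero_iff.2 hM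
  have e0 := congrFun hMv 0
  have e1 := congrFun hMv 1
  have e2 := congrFun hMv 2
  simp only [Matrix.mulVec, dotProduct, Fin.sum_univ_three, cevianMatrix, Matrix.of_apply, Matrix.cons_val,
    Pi.zero_apply] at e0 e1 e2
  -- These mixed coefficients work for a single triple. That `v` lies in the kernel says that both
  -- triples give the same `h`, `f`, `g` (rows 0, 1, 2).
  have key : ∀ p q r f g h : ℝ, p ≠ 0 → q ≠ 0 → r ≠ 0 →
      f = v 1 / p + p * v 2 - q * v 0 / r →
      g = v 2 / q + q * v 0 - r * v 1 / p →
      h = v 0 / r + r * v 1 - p * v 2 / q →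
      ternary (-v 0) (-v 1) (-v 2) f g h ![q, q * r, 1] = 0 ∧
      ternary (-v 0) (-v 1) (-v 2) f g h ![1, r, p * r] = 0 ∧
      ternary (-v 0) (-v 1) (-v 2) f g h ![q * p, 1, p] = 0 := by
    intro p q r f g h hp hq hr hf hg hh
    simp only [ternary_apply, Matrix.cons_val, hf, hg, hh]
    refine ⟨?_, ?_, ?_⟩ <;> field_simp <;> ring
  obtain ⟨x₁, y₁, z₁⟩ := key p₁ q₁ r₁ _ _ _ hp₁ hq₁ hr₁ rfl rfl rfl
  obtain ⟨x₂, y₂, z₂⟩ := key p₂ q₂ r₂ (v 1 / p₁ + p₁ * v 2 - q₁ * v 0 / r₁)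
    (v 2 / q₁ + q₁ * v 0 - r₁ * v 1 / p₁) (v 0 / r₁ + r₁ * v 1 - p₁ * v 2 / q₁) hp₂ hq₂ hr₂
    (by linear_combination e1) (by linear_combination e2) (by linear_combination e0)
  refine ⟨_, fun h0 => hv ?_, x₁, x₂, y₁, y₂, z₁, z₂⟩
  have a0 := congrArg (fun F : QuadraticForm ℝ (Fin 3 → ℝ) => F ![1, 0, 0]) h0
  have a1 := congrArg (fun F : QuadraticForm ℝ (Fin 3 → ℝ) => F ![0, 1, 0]) h0
  have a2 := congrArg (fun F : QuadraticForm ℝ (Fin 3 → ℝ) => F ![0, 0, 1]) h0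
  simp [ternary_apply] at a0 a1 a2
  ext i; fin_cases i <;> simp [a0, a1, a2]

/-- The equation of a conic through the vertices of a nondegenerate cevian triangle. -/
theorem ternary_coeff_of_cevian_triangle {p q r α β γ f g h : ℝ} (hp : p ≠ 0) (hq : q ≠ 0)
    (hr : r ≠ 0) (hk : p * q * r ≠ 1)
    (hX : ternary α β γ f g h ![q, q * r, 1] = 0)
    (hY : ternary α β γ f g h ![1, r, p * r] = 0)
    (hZ : ternary α β γ f g h ![q * p, 1, p] = 0) :
    f + β / p + p * γ - q * α / r = 0 ∧
    g + γ / q + q * α - r * β / p = 0 ∧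
    h + α / r + r * β - p * γ / q = 0 := by
  simp only [ternary_apply, Matrix.cons_val] at hX hY hZ
  have hd := sub_ne_zero.2 hk
  -- With the deviations `F`, `G`, `H` from the expected mixed coefficients as unknowns, the three
  -- incidences become a homogeneous linear system; elimination leaves the factor `pqr - 1`, nonzero
  -- for a non-concurrent triple.
  set F := f + β / p + p * γ - q * α / r with hF
  set G := g + γ / q + q * α - r * β / p with hG
  set H := h + α / r + r * β - p * γ / q with hH
  have ef : f = F - (β / p + p * γ - q * α / r) := by rw [hF]; ring
  have eg : g = G - (γ / q + q * α - r * β / p) := by rw [hG]; ring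
  have eh : h = H - (α / r + r * β - p * γ / q) := by rw [hH]; ring
  clear_value F G H
  subst ef eg eh
  have x : r * F + G + q * r * H = 0 := by
    apply mul_left_cancel₀ hq
    rw [mul_zero, ← hX]
    field_simp
    ring
  have y : p * r * F + p * G + H = 0 := by
    apply mul_left_cancel₀ hr
    rw [mul_zero, ← hY]
    field_simp
    ring
  have z : F + p * q * G + q * H = 0 := by
    apply mul_left_cancel₀ hp
    rw [mul_zero, ← hZ]
    field_simp
    ring
  have hH0 : H = 0 := mul_left_cancel₀ hd (by linear_combination p * x - y)
  subst hH0
  have hF0 : F = 0 := mul_left_cancel₀ hd (by linear_combination p * q * x - z)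
  subst hF0
  exact ⟨rfl, by linear_combination x, rfl⟩

/-- Non-concurrency makes both triples prescribe the mixed coefficients linearly in `(α, β, γ)`.
Comparing them puts this vector in the kernel of `cevianMatrix`, and it is nonzero because otherwise
the whole form would vanish. -/
theorem carnot_of_form_cevian_triangles {p₁ p₂ q₁ q₂ r₁ r₂ : ℝ} (hp₁ : p₁ ≠ 0) (hp₂ : p₂ ≠ 0)
    (hq₁ : q₁ ≠ 0) (hq₂ : q₂ ≠ 0) (hr₁ : r₁ ≠ 0) (hr₂ : r₂ ≠ 0)
    (hp : p₁ ≠ p₂) (hq : q₁ ≠ q₂) (hr : r₁ ≠ r₂) (h₁ : p₁ * q₁ * r₁ ≠ 1) (h₂ : p₂ * q₂ * r₂ ≠ 1)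
    {F : QuadraticForm ℝ (Fin 3 → ℝ)} (hF : F ≠ 0)
    (x₁ : F ![q₁, q₁ * r₁, 1] = 0) (x₂ : F ![q₂, q₂ * r₂, 1] = 0)
    (y₁ : F ![1, r₁, p₁ * r₁] = 0) (y₂ : F ![1, r₂, p₂ * r₂] = 0)
    (z₁ : F ![q₁ * p₁, 1, p₁] = 0) (z₂ : F ![q₂ * p₂, 1, p₂] = 0) :
    p₁ * p₂ * q₁ * q₂ * r₁ * r₂ = 1 := by
  obtain ⟨α, β, γ, f, g, h, rfl⟩ := exists_eq_ternary F
  obtain ⟨f₁, g₁, h₁⟩ := ternary_coeff_of_cevian_triangle hp₁ hq₁ hr₁ h₁ x₁ y₁ z₁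
  obtain ⟨f₂, g₂, h₂⟩ := ternary_coeff_of_cevian_triangle hp₂ hq₂ hr₂ h₂ x₂ y₂ z₂
  have hM : (cevianMatrix p₁ p₂ q₁ q₂ r₁ r₂).det = 0 := by
    refine Matrix.exists_mulVec_eq_zero_iff.1 ⟨![α, β, γ], fun h0 => hF ?_, ?_⟩
    · have a0 := congrFun h0 0
      have a1 := congrFun h0 1
      have a2 := congrFun h0 2
      simp only [Matrix.cons_val, Pi.zero_apply] at a0 a1 a2
      subst a0 a1 a2
      simp only [mul_zero, zero_div, add_zero, sub_zero] at f₁ g₁ h₁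
      subst f₁ g₁ h₁
      exact ternary_zero
    · ext i
      fin_cases i <;> simp only [Matrix.mulVec, dotProduct, Fin.sum_univ_three, cevianMatrix,
        Matrix.of_apply, Matrix.cons_val, Pi.zero_apply, Fin.zero_eta, Fin.mk_one,
        Fin.reduceFinMk]
      · linear_combination h₁ - h₂
      · linear_combination f₁ - f₂
      · linear_combination g₁ - g₂
  have := det_cevianMatrix hp₁ hp₂ hq₁ hq₂ hr₁ hr₂
  rw [hM, zero_mul, eq_comm, mul_eq_zero] at this
  have hne : (p₁ - p₂) * (q₁ - q₂) * (r₁ - r₂) ≠ 0 :=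
    mul_ne_zero (mul_ne_zero (sub_ne_zero.2 hp) (sub_ne_zero.2 hq)) (sub_ne_zero.2 hr)
  exact sub_eq_zero.1 (this.resolve_right hne)

/-- The discriminant of the dual conic touching six cevians. -/
theorem dual_discriminant {p₁ p₂ q₁ q₂ r₁ r₂ : ℝ} (hD : p₁ * p₂ * q₁ * q₂ * r₁ * r₂ = 1) :
    4 * (p₁ * p₂ * q₁ * q₂) * 1 * (p₁ * p₂) - (p₁ * p₂ * q₁ * q₂) * (p₁ + p₂) ^ 2 -
      1 * (p₁ * p₂ * (q₁ + q₂)) ^ 2 - (p₁ * p₂) * (p₁ * p₂ * q₁ * q₂ * (r₁ + r₂)) ^ 2 +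
      (p₁ + p₂) * (p₁ * p₂ * (q₁ + q₂)) * (p₁ * p₂ * q₁ * q₂ * (r₁ + r₂)) =
    -(p₁ * p₂ ^ 3 * q₁ * q₂) * ((1 - p₁ * q₁ * r₁) * (1 - p₁ * q₁ * r₂) * (1 - p₁ * q₂ * r₁) *
      (1 - p₁ * q₂ * r₂)) := by
  have h0 : p₁ * p₂ * q₁ * q₂ * r₁ ≠ 0 := by
    intro h; rw [h, zero_mul] at hD; exact zero_ne_one hD
  have hr : r₂ = 1 / (p₁ * p₂ * q₁ * q₂ * r₁) := by
    rw [eq_div_iff h0]; linear_combination hD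
  have : p₁ ≠ 0 ∧ p₂ ≠ 0 ∧ q₁ ≠ 0 ∧ q₂ ≠ 0 ∧ r₁ ≠ 0 := by
    refine ⟨?_, ?_, ?_, ?_, ?_⟩ <;> rintro rfl <;> simp at h0
  obtain ⟨_, _, _, _, _⟩ := this
  subst hr
  field_simp
  ring

/-! ### Coordinates -/

theorem mem_line_iff {P Q R : Plane} :
    R ∈ line P Q ↔ ∃ s t : ℝ, R.rep = s • P.rep + t • Q.rep := by
  have h : line P Q = (Submodule.span ℝ {P.rep, Q.rep}).projectivization := by
    apply Projectivization.Subspace.span_eq_of_le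
    · rintro S (rfl | rfl)
      · rw [← S.mk_rep]
        exact (Submodule.mk_mem_projectivization_iff _ S.rep_nonzero).2
          (Submodule.subset_span (by simp))
      · rw [← S.mk_rep]
        exact (Submodule.mk_mem_projectivization_iff _ S.rep_nonzero).2
          (Submodule.subset_span (by simp))
    · rw [← OrderIso.le_symm_apply, Submodule.span_le]
      rintro v (rfl | rfl)
      · refine (Projectivization.Subspace.mem_submodule_iff _ P.rep_nonzero).2 ?_
        rw [P.mk_rep]
        exact Projectivization.Subspace.subset_span _ (by simp)
      · refine (Projectivization.Subspace.mem_submodule_iff _ Q.rep_nonzero).2 ?_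
        rw [Q.mk_rep]
        exact Projectivization.Subspace.subset_span _ (by simp)
  rw [h, ← R.mk_rep, Submodule.mk_mem_projectivization_iff, R.mk_rep, Submodule.mem_span_pair]
  simp only [eq_comm]

theorem eq_of_rep_eq_smul {P Q : Plane} {k : ℝ} (h : P.rep = k • Q.rep) : P = Q := by
  rw [← P.mk_rep, ← Q.mk_rep, Projectivization.mk_eq_mk_iff']
  exact ⟨k, h.symm⟩

theorem exists_mk_rep (v : Fin 3 → ℝ) (hv : v ≠ 0) :
    ∃ P : Plane, ∃ k : ℝ, k ≠ 0 ∧ P.rep = k • v := by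
  obtain ⟨a, ha⟩ := Projectivization.exists_smul_eq_mk_rep ℝ v hv
  exact ⟨_, a, a.ne_zero, ha.symm⟩

/-- The foot of a cevian has an affine coordinate on its side line. -/
theorem IsFoot.exists_coord {A₁ B C : Plane} (h : IsFoot A₁ B C) :
    ∃ p k : ℝ, p ≠ 0 ∧ k ≠ 0 ∧ A₁.rep = k • (B.rep + p • C.rep) := by
  obtain ⟨hl, hB, hC⟩ := h
  obtain ⟨s, t, hst⟩ := mem_line_iff.1 hl
  have hs : s ≠ 0 := by
    rintro rfl
    exact hC (eq_of_rep_eq_smul (k := t) (by simpa using hst))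
  have ht : t ≠ 0 := by
    rintro rfl
    exact hB (eq_of_rep_eq_smul (k := s) (by simpa using hst))
  refine ⟨t / s, s, div_ne_zero ht hs, hs, ?_⟩
  rw [hst, smul_add, smul_smul, mul_div_cancel₀ _ hs]

theorem coord_ne {A₁ A₂ B C : Plane} {p₁ p₂ k₁ k₂ : ℝ} (hk₂ : k₂ ≠ 0)
    (h₁ : A₁.rep = k₁ • (B.rep + p₁ • C.rep)) (h₂ : A₂.rep = k₂ • (B.rep + p₂ • C.rep))
    (h : A₁ ≠ A₂) : p₁ ≠ p₂ := by
  rintro rfl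
  refine h (eq_of_rep_eq_smul (k := k₁ / k₂) ?_)
  rw [h₁, h₂, smul_smul, div_mul_cancel₀ _ hk₂]

/-- Homogeneous coordinates in which the vertices of a triangle are the coordinate points. -/
theorem exists_coordinates {A B C : Plane} (h : Projectivization.Independent ![A, B, C]) :
    ∃ φ : (Fin 3 → ℝ) ≃ₗ[ℝ] (Fin 3 → ℝ),
      φ A.rep = ![1, 0, 0] ∧ φ B.rep = ![0, 1, 0] ∧ φ C.rep = ![0, 0, 1] := by
  rw [Projectivization.independent_iff] at h
  let b := basisOfLinearIndependentOfCardEqFinrank h (by simp)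
  have hb : ∀ i, b.equivFun ((![A, B, C] i).rep) = Pi.single i 1 := by
    intro i
    have : (![A, B, C] i).rep = b i := by simp [b]
    rw [this]
    ext j
    simp [Pi.single_apply, eq_comm]
  refine ⟨b.equivFun, ?_, ?_, ?_⟩
  · refine (hb 0).trans ?_
    ext i; fin_cases i <;> simp
  · refine (hb 1).trans ?_
    ext i; fin_cases i <;> simp
  · refine (hb 2).trans ?_
    ext i; fin_cases i <;> simp

variable (φ : (Fin 3 → ℝ) ≃ₗ[ℝ] (Fin 3 → ℝ))

/-- In the coordinates `φ`, the point `P` has homogeneous coordinates `v`. -/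
def HasCoord (P : Plane) (v : Fin 3 → ℝ) : Prop :=
  ∃ k : ℝ, k ≠ 0 ∧ φ P.rep = k • v

/-- In the coordinates `φ`, the line `l` has line coordinates `u`. -/
def HasLineCoord (l : Projectivization.Subspace ℝ (Fin 3 → ℝ)) (u : Fin 3 → ℝ) : Prop :=
  ∀ R : Plane, R ∈ l ↔ u ⬝ᵥ φ R.rep = 0

variable {φ}

theorem coord_ne_zero (P : Plane) : φ P.rep ≠ 0 := by
  simpa using P.rep_nonzero

theorem exists_hasCoord {v : Fin 3 → ℝ} (hv : v ≠ 0) : ∃ P, HasCoord φ P v := by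
  obtain ⟨P, k, hk, hP⟩ := exists_mk_rep (φ.symm v) (by simpa using hv)
  exact ⟨P, k, hk, by rw [hP, map_smul, LinearEquiv.apply_symm_apply]⟩

theorem HasLineCoord.mem_iff {l : Projectivization.Subspace ℝ (Fin 3 → ℝ)} {u v : Fin 3 → ℝ}
    {P : Plane} (hl : HasLineCoord φ l u) (hP : HasCoord φ P v) : P ∈ l ↔ u ⬝ᵥ v = 0 := by
  obtain ⟨k, hk, hP⟩ := hP
  rw [hl P, hP, dotProduct_smul, smul_eq_mul, mul_eq_zero, or_iff_right hk]

theorem HasCoord.eq {P Q : Plane} {v w : Fin 3 → ℝ} {c : ℝ} (hP : HasCoord φ P v)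
    (hQ : HasCoord φ Q w) (h : v = c • w) : P = Q := by
  obtain ⟨k, hk, hP⟩ := hP
  obtain ⟨m, hm, hQ⟩ := hQ
  apply eq_of_rep_eq_smul (k := k * c / m)
  apply φ.injective
  rw [map_smul, hP, hQ, h, smul_smul, smul_smul, div_mul_cancel₀ _ hm]

theorem HasCoord.exists_smul {P : Plane} {v w : Fin 3 → ℝ} (hP : HasCoord φ P v)
    (hQ : HasCoord φ P w) : ∃ c : ℝ, v = c • w := by
  obtain ⟨k, hk, hP⟩ := hP
  obtain ⟨m, hm, hQ⟩ := hQ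
  refine ⟨k⁻¹ * m, ?_⟩
  rw [mul_smul, ← hQ, hP, smul_smul, inv_mul_cancel₀ hk, one_smul]

theorem lieOnOneConic_iff {S : Set Plane} (φ : (Fin 3 → ℝ) ≃ₗ[ℝ] (Fin 3 → ℝ)) :
    LieOnOneConic S ↔ ∃ F : QuadraticForm ℝ (Fin 3 → ℝ), F ≠ 0 ∧
      ∀ P ∈ S, ∀ v, HasCoord φ P v → F v = 0 := by
  constructor
  · rintro ⟨q, hq, h⟩
    refine ⟨q.comp φ.symm.toLinearMap, fun h0 => hq ?_, ?_⟩
    · ext v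
      simpa using congrArg (fun F : QuadraticForm ℝ (Fin 3 → ℝ) => F (φ v)) h0
    · rintro P hP v ⟨k, hk, hv⟩
      have h1 := h P hP
      have hr : P.rep = k • φ.symm v := by
        rw [← map_smul, ← hv, LinearEquiv.symm_apply_apply]
      rw [OnConic, hr, QuadraticMap.map_smul] at h1
      simpa [hk] using h1
  · rintro ⟨F, hF, h⟩
    refine ⟨F.comp φ.toLinearMap, fun h0 => hF ?_, ?_⟩
    · ext v
      simpa using congrArg (fun q : QuadraticForm ℝ (Fin 3 → ℝ) => q (φ.symm v)) h0
    · intro P hP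
      exact h P hP _ ⟨1, one_ne_zero, (one_smul _ _).symm⟩

theorem lieOnOneConic_six_iff {P₁ P₂ P₃ P₄ P₅ P₆ : Plane} {v₁ v₂ v₃ v₄ v₅ v₆ : Fin 3 → ℝ}
    (h₁ : HasCoord φ P₁ v₁) (h₂ : HasCoord φ P₂ v₂) (h₃ : HasCoord φ P₃ v₃)
    (h₄ : HasCoord φ P₄ v₄) (h₅ : HasCoord φ P₅ v₅) (h₆ : HasCoord φ P₆ v₆) :
    LieOnOneConic {P₁, P₂, P₃, P₄, P₅, P₆} ↔
      ∃ F : QuadraticForm ℝ (Fin 3 → ℝ), F ≠ 0 ∧ F v₁ = 0 ∧ F v₂ = 0 ∧ F v₃ = 0 ∧ F v₄ = 0 ∧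
        F v₅ = 0 ∧ F v₆ = 0 := by
  rw [lieOnOneConic_iff φ]
  constructor
  · rintro ⟨F, hF, h⟩
    exact ⟨F, hF, h _ (by simp) _ h₁, h _ (by simp) _ h₂, h _ (by simp) _ h₃,
      h _ (by simp) _ h₄, h _ (by simp) _ h₅, h _ (by simp) _ h₆⟩
  · rintro ⟨F, hF, e₁, e₂, e₃, e₄, e₅, e₆⟩
    refine ⟨F, hF, ?_⟩
    have key : ∀ {P : Plane} {v}, HasCoord φ P v → F v = 0 → ∀ w, HasCoord φ P w → F w = 0 := by
      intro P v hv h0 w hw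
      obtain ⟨c, rfl⟩ := hw.exists_smul hv
      rw [QuadraticMap.map_smul, h0, smul_zero]
    rintro P (rfl | rfl | rfl | rfl | rfl | rfl)
    exacts [key h₁ e₁, key h₂ e₂, key h₃ e₃, key h₄ e₄, key h₅ e₅, key h₆ e₆]

/-! ### Dual conics -/

/-- The dot product is definite: `a` minus its projection to `u` is orthogonal to itself. -/
theorem exists_smul_of_dotProduct {a u : Fin 3 → ℝ} (hu : u ≠ 0)
    (h : ∀ r, u ⬝ᵥ r = 0 → a ⬝ᵥ r = 0) : ∃ c : ℝ, a = c • u := by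
  have huu : u ⬝ᵥ u ≠ 0 := by simpa using hu
  refine ⟨(a ⬝ᵥ u) / (u ⬝ᵥ u), ?_⟩
  set c := (a ⬝ᵥ u) / (u ⬝ᵥ u) with hc
  have h1 : u ⬝ᵥ (a - c • u) = 0 := by
    rw [dotProduct_sub, dotProduct_smul, smul_eq_mul, hc, div_mul_cancel₀ _ huu,
      dotProduct_comm, sub_self]
  have h2 := h _ h1
  have h3 : (a - c • u) ⬝ᵥ (a - c • u) = 0 := by
    rw [sub_dotProduct, h2, smul_dotProduct, h1, smul_zero, sub_zero]
  exact sub_eq_zero.1 (dotProduct_self_eq_zero.1 h3)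

/-- The tangents of a conic lie on the dual conic. -/
theorem exists_dual_form (φ : (Fin 3 → ℝ) ≃ₗ[ℝ] (Fin 3 → ℝ))
    {L : Set (Projectivization.Subspace ℝ (Fin 3 → ℝ))} (h : TouchOneConic L) :
    ∃ F : QuadraticForm ℝ (Fin 3 → ℝ), F ≠ 0 ∧
      ∀ l ∈ L, ∀ u, u ≠ 0 → HasLineCoord φ l u → F u = 0 := by
  rcases h with ⟨q, hq, hL⟩ | ⟨P, Q, hPQ⟩
  · have hq' : (q.comp φ.symm.toLinearMap).Nondegenerate := by
      refine nondegenerate_of_polar fun v hv => ?_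
      have : φ.symm v = 0 := eq_zero_of_polar hq fun w => by
        simpa [QuadraticMap.polar] using hv (φ w)
      simpa using this
    obtain ⟨T, hT⟩ := exists_polar_equiv hq'
    -- The tangent at `P` has line coordinates `T (φ P.rep)`, so transporting the form by `T⁻¹`
    -- gives the dual conic.
    refine ⟨(q.comp φ.symm.toLinearMap).comp T.symm.toLinearMap, fun h0 => ?_, ?_⟩
    · have hz : q.comp φ.symm.toLinearMap = 0 := by
        ext v
        simpa using congrArg (fun F : QuadraticForm ℝ (Fin 3 → ℝ) => F (T v)) h0
      have : (![1, 0, 0] : Fin 3 → ℝ) = 0 := eq_zero_of_polar hq' fun w => by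
        simp [hz, QuadraticMap.polar]
      simpa using congrFun this 0
    · intro l hl u hu hlu
      obtain ⟨P, -, hPq, hPl⟩ := hL l hl
      have hc : ∃ c : ℝ, T (φ P.rep) = c • u := by
        refine exists_smul_of_dotProduct hu fun r hr => ?_
        rcases eq_or_ne r 0 with rfl | hr0
        · exact dotProduct_zero _
        obtain ⟨R, hR⟩ := exists_hasCoord (φ := φ) hr0
        have h1 := hPl R ((hlu.mem_iff hR).2 hr)
        obtain ⟨k, hk, hR⟩ := hR
        have h2 : T (φ P.rep) ⬝ᵥ φ R.rep = 0 := by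
          rw [← hT]
          simpa [QuadraticMap.polar, ← map_add] using h1
        rw [hR, dotProduct_smul, smul_eq_mul, mul_eq_zero, or_iff_right hk] at h2
        exact h2
      obtain ⟨c, hc⟩ := hc
      have hc0 : c ≠ 0 := by
        rintro rfl
        rw [zero_smul] at hc
        exact coord_ne_zero (φ := φ) P (by simpa using hc)
      have hP : φ P.rep = c • T.symm u := by
        rw [← map_smul, ← hc, LinearEquiv.symm_apply_apply]
      have h1 : (q.comp φ.symm.toLinearMap) (φ P.rep) = 0 := by simpa [OnConic] using hPq
      rw [hP, QuadraticMap.map_smul, smul_eq_mul, mul_eq_zero] at h1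
      exact h1.resolve_left (mul_ne_zero hc0 hc0)
  · let ev : (Fin 3 → ℝ) → (Fin 3 → ℝ) →ₗ[ℝ] ℝ := fun p => dotProductBilin ℝ ℝ p
    refine ⟨QuadraticMap.linMulLin (ev (φ P.rep)) (ev (φ Q.rep)), fun h0 => ?_, ?_⟩
    · have h1 : ∀ u, (φ P.rep ⬝ᵥ u) * (φ Q.rep ⬝ᵥ u) = 0 := fun u =>
        congrArg (fun F : QuadraticForm ℝ (Fin 3 → ℝ) => F u) h0
      have hP : φ P.rep ⬝ᵥ φ P.rep ≠ 0 := by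
        simpa using P.rep_nonzero
      have hQ : φ Q.rep ⬝ᵥ φ Q.rep ≠ 0 := by
        simpa using Q.rep_nonzero
      -- A product of two nonzero linear forms is nonzero: its vanishing at `P` would make `P` and
      -- `Q` orthogonal, and at `P + Q` its value would then be `|P|²|Q|² ≠ 0`.
      have h2 := (mul_eq_zero.1 (h1 (φ P.rep))).resolve_left hP
      have h3 := h1 (φ P.rep + φ Q.rep)
      rw [dotProduct_add, dotProduct_add, dotProduct_comm (φ P.rep) (φ Q.rep), h2, add_zero,
        zero_add] at h3
      exact mul_ne_zero hP hQ h3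
    · intro l hl u _ hlu
      change (φ P.rep ⬝ᵥ u) * (φ Q.rep ⬝ᵥ u) = 0
      rw [mul_eq_zero, dotProduct_comm, dotProduct_comm (φ Q.rep)]
      exact (hPQ l hl).imp (hlu P).1 (hlu Q).1

/-- Lines on a nondegenerate dual conic are tangents of a nondegenerate conic. -/
theorem touchOneConic_of_dual (φ : (Fin 3 → ℝ) ≃ₗ[ℝ] (Fin 3 → ℝ))
    {L : Set (Projectivization.Subspace ℝ (Fin 3 → ℝ))} {F : QuadraticForm ℝ (Fin 3 → ℝ)}
    (hF : F.Nondegenerate) (h : ∀ l ∈ L, ∃ u, u ≠ 0 ∧ HasLineCoord φ l u ∧ F u = 0) :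
    TouchOneConic L := by
  obtain ⟨T, hT⟩ := exists_polar_equiv hF
  have hpol : ∀ x y, QuadraticMap.polar (F.comp (φ.trans T.symm).toLinearMap) x y =
      φ x ⬝ᵥ T.symm (φ y) := by
    intro x y
    have := hT (T.symm (φ x)) (T.symm (φ y))
    rw [LinearEquiv.apply_symm_apply] at this
    rw [← this]
    simp [QuadraticMap.polar]
  have hsymm : ∀ u y, T u ⬝ᵥ T.symm y = u ⬝ᵥ y := by
    intro u y
    rw [← hT, QuadraticMap.polar_comm, hT, LinearEquiv.apply_symm_apply, dotProduct_comm]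
  refine Or.inl ⟨F.comp (φ.trans T.symm).toLinearMap, ?_, fun l hl => ?_⟩
  · refine nondegenerate_of_polar fun v hv => ?_
    have := hv (φ.symm (T (φ v)))
    rw [hpol] at this
    simpa using this
  · obtain ⟨u, hu, hlu, hFu⟩ := h l hl
    -- The point of contact is the pole `T u` of the line `u`.
    obtain ⟨P, k, hk, hP⟩ := exists_hasCoord (φ := φ) (v := T u) (by simpa using hu)
    refine ⟨P, (hlu P).2 ?_, ?_, fun R hR => ?_⟩
    · have h1 : u ⬝ᵥ T u = 0 := by
        rw [dotProduct_comm, ← hT, QuadraticMap.polar_self, hFu, smul_zero]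
      rw [hP, dotProduct_smul, h1, smul_zero]
    · simp [OnConic, hP, QuadraticMap.map_smul, hFu]
    · rw [hpol, hP, smul_dotProduct, hsymm, (hlu R).1 hR, smul_zero]

/-! ### Lines through the vertices of the coordinate triangle -/

theorem HasCoord.mem_line_iff {P Q R : Plane} {v w : Fin 3 → ℝ} (hP : HasCoord φ P v)
    (hQ : HasCoord φ Q w) : R ∈ line P Q ↔ ∃ s t : ℝ, φ R.rep = s • v + t • w := by
  obtain ⟨k, hk, hP⟩ := hP
  obtain ⟨m, hm, hQ⟩ := hQ
  rw [CevianConics.mem_line_iff]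
  constructor
  · rintro ⟨s, t, h⟩
    exact ⟨s * k, t * m, by rw [h, map_add, map_smul, map_smul, hP, hQ, smul_smul, smul_smul]⟩
  · rintro ⟨s, t, h⟩
    refine ⟨s / k, t / m, φ.injective ?_⟩
    rw [h, map_add, map_smul, map_smul, hP, hQ, smul_smul, smul_smul, div_mul_cancel₀ _ hk,
      div_mul_cancel₀ _ hm]

/-- Here and in the two analogues, the line coordinates are minus the cross product of the two
points. -/
theorem hasLineCoord_fst {P Q : Plane} {x y z : ℝ} (hP : HasCoord φ P ![1, 0, 0])
    (hQ : HasCoord φ Q ![x, y, z]) (hy : y ≠ 0) : HasLineCoord φ (line P Q) ![0, z, -y] := by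
  intro R
  rw [hP.mem_line_iff hQ]
  simp only [dotProduct, Fin.sum_univ_three, Matrix.cons_val]
  constructor
  · rintro ⟨s, t, h⟩
    simp [h]
    ring
  · intro h
    refine ⟨φ R.rep 0 - φ R.rep 1 / y * x, φ R.rep 1 / y, ?_⟩
    ext i
    fin_cases i <;> simp
    · field_simp
    · field_simp
      linear_combination -h

theorem hasLineCoord_snd {P Q : Plane} {x y z : ℝ} (hP : HasCoord φ P ![0, 1, 0])
    (hQ : HasCoord φ Q ![x, y, z]) (hz : z ≠ 0) : HasLineCoord φ (line P Q) ![-z, 0, x] := by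
  intro R
  rw [hP.mem_line_iff hQ]
  simp only [dotProduct, Fin.sum_univ_three, Matrix.cons_val]
  constructor
  · rintro ⟨s, t, h⟩
    simp [h]
    ring
  · intro h
    refine ⟨φ R.rep 1 - φ R.rep 2 / z * y, φ R.rep 2 / z, ?_⟩
    ext i
    fin_cases i <;> simp
    · field_simp
      linear_combination -h
    · field_simp

theorem hasLineCoord_thd {P Q : Plane} {x y z : ℝ} (hP : HasCoord φ P ![0, 0, 1])
    (hQ : HasCoord φ Q ![x, y, z]) (hx : x ≠ 0) : HasLineCoord φ (line P Q) ![y, -x, 0] := by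
  intro R
  rw [hP.mem_line_iff hQ]
  simp only [dotProduct, Fin.sum_univ_three, Matrix.cons_val]
  constructor
  · rintro ⟨s, t, h⟩
    simp [h]
    ring
  · intro h
    refine ⟨φ R.rep 2 - φ R.rep 0 / x * z, φ R.rep 0 / x, ?_⟩
    ext i
    fin_cases i <;> simp
    · field_simp
    · field_simp
      linear_combination -h

/-- Representatives are nonzero, so the factor cannot vanish; points of intersection thus get
coordinates without a separate check of the scalar. -/
theorem HasCoord.of_eq {P : Plane} {v : Fin 3 → ℝ} {c : ℝ} (h : φ P.rep = c • v) :
    HasCoord φ P v := by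
  refine ⟨c, ?_, h⟩
  rintro rfl
  exact coord_ne_zero P (h.trans (zero_smul _ _))

theorem IsMeet.hasCoord_snd_thd {P : Plane} {l m : Projectivization.Subspace ℝ (Fin 3 → ℝ)}
    {q r : ℝ} (h : IsMeet P l m) (hl : HasLineCoord φ l ![-1, 0, q])
    (hm : HasLineCoord φ m ![r, -1, 0]) : HasCoord φ P ![q, q * r, 1] := by
  have h1 := (hl P).1 h.1
  have h2 := (hm P).1 h.2
  simp only [dotProduct, Fin.sum_univ_three, Matrix.cons_val] at h1 h2
  apply HasCoord.of_eq (c := φ P.rep 2)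
  ext i
  fin_cases i <;> simp
  · linear_combination -h1
  · linear_combination -h2 - r * h1

theorem IsMeet.hasCoord_fst_thd {P : Plane} {l m : Projectivization.Subspace ℝ (Fin 3 → ℝ)}
    {p r : ℝ} (h : IsMeet P l m) (hl : HasLineCoord φ l ![0, p, -1])
    (hm : HasLineCoord φ m ![r, -1, 0]) : HasCoord φ P ![1, r, p * r] := by
  have h1 := (hl P).1 h.1
  have h2 := (hm P).1 h.2
  simp only [dotProduct, Fin.sum_univ_three, Matrix.cons_val] at h1 h2
  apply HasCoord.of_eq (c := φ P.rep 0)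
  ext i
  fin_cases i <;> simp
  · linear_combination -h2
  · linear_combination -h1 - p * h2

theorem IsMeet.hasCoord_fst_snd {P : Plane} {l m : Projectivization.Subspace ℝ (Fin 3 → ℝ)}
    {p q : ℝ} (h : IsMeet P l m) (hl : HasLineCoord φ l ![0, p, -1])
    (hm : HasLineCoord φ m ![-1, 0, q]) : HasCoord φ P ![q * p, 1, p] := by
  have h1 := (hl P).1 h.1
  have h2 := (hm P).1 h.2
  simp only [dotProduct, Fin.sum_univ_three, Matrix.cons_val] at h1 h2
  apply HasCoord.of_eq (c := φ P.rep 1)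
  ext i
  fin_cases i <;> simp
  · linear_combination -h2 - q * h1
  · linear_combination -h1

/-! ### Concurrency of lines through the vertices -/

/-- **Ceva's theorem**: the vertices of a cevian triangle coincide if and only if the product of
the coordinates of the feet is one. -/
theorem ceva {X Y Z : Plane} {p q r : ℝ} (hX : HasCoord φ X ![q, q * r, 1])
    (hY : HasCoord φ Y ![1, r, p * r]) (hZ : HasCoord φ Z ![q * p, 1, p]) :
    (X = Y ∧ Y = Z) ↔ p * q * r = 1 := by
  constructor
  · rintro ⟨rfl, -⟩
    obtain ⟨c, hc⟩ := hX.exists_smul hY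
    have h0 := congrFun hc 0
    have h2 := congrFun hc 2
    simp at h0 h2
    rw [h2, h0]
    ring
  · intro h
    refine ⟨hX.eq hY (c := q) ?_, hY.eq hZ (c := r) ?_⟩ <;> ext i <;> fin_cases i <;> simp <;>
      first | ring1 | linear_combination -h

/-- Three lines through the vertices of the coordinate triangle are concurrent if and only if the
product of their slopes is one. -/
theorem existsUnique_mem_iff {l m n : Projectivization.Subspace ℝ (Fin 3 → ℝ)} {a b c : ℝ}
    (hl : HasLineCoord φ l ![0, 1, -a]) (hm : HasLineCoord φ m ![-b, 0, 1])
    (hn : HasLineCoord φ n ![1, -c, 0]) :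
    (∃! O : Plane, O ∈ l ∧ O ∈ m ∧ O ∈ n) ↔ a * b * c = 1 := by
  -- `l` and `n` alone determine `O`, which gives uniqueness; incidence with `m` is then the product
  -- condition.
  have hcoord : ∀ O, O ∈ l → O ∈ m → O ∈ n → HasCoord φ O ![a * c, a, 1] := by
    intro O h1 h2 h3
    rw [hl O] at h1
    rw [hn O] at h3
    simp only [dotProduct, Fin.sum_univ_three, Matrix.cons_val] at h1 h3
    apply HasCoord.of_eq (c := φ O.rep 2)
    ext i
    fin_cases i <;> simp
    · linear_combination h3 + c * h1
    · linear_combination h1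
  constructor
  · rintro ⟨O, ⟨h1, h2, h3⟩, -⟩
    have := (hm.mem_iff (hcoord O h1 h2 h3)).1 h2
    simp only [dotProduct, Fin.sum_univ_three, Matrix.cons_val] at this
    linear_combination -this
  · intro h
    obtain ⟨O, hO⟩ := exists_hasCoord (φ := φ) (v := ![a * c, a, 1])
      fun h0 => by simpa using congrFun h0 2
    refine ⟨O, ⟨(hl.mem_iff hO).2 ?_, (hm.mem_iff hO).2 ?_, (hn.mem_iff hO).2 ?_⟩, ?_⟩
    · simp [dotProduct, Fin.sum_univ_three]
    · simp only [dotProduct, Fin.sum_univ_three, Matrix.cons_val]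
      linear_combination -h
    · simp only [dotProduct, Fin.sum_univ_three, Matrix.cons_val]
      ring
    · rintro P ⟨h1, h2, h3⟩
      exact (hcoord P h1 h2 h3).eq hO (one_smul _ _).symm

/-- The converse of Ceva's theorem for two triples of cevians. -/
theorem exists_concurrency_points {l₁ l₂ m₁ m₂ n₁ n₂ : Projectivization.Subspace ℝ (Fin 3 → ℝ)}
    {p₁ p₂ q₁ q₂ r₁ r₂ : ℝ}
    (hl₁ : HasLineCoord φ l₁ ![0, p₁, -1]) (hl₂ : HasLineCoord φ l₂ ![0, p₂, -1])
    (hm₁ : HasLineCoord φ m₁ ![-1, 0, q₁]) (hm₂ : HasLineCoord φ m₂ ![-1, 0, q₂])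
    (hn₁ : HasLineCoord φ n₁ ![r₁, -1, 0]) (hn₂ : HasLineCoord φ n₂ ![r₂, -1, 0])
    (h₁ : p₁ * q₁ * r₁ = 1) (h₂ : p₂ * q₂ * r₂ = 1) :
    ∃ P Q : Plane, P ∈ l₁ ∧ P ∈ m₁ ∧ P ∈ n₁ ∧ Q ∈ l₂ ∧ Q ∈ m₂ ∧ Q ∈ n₂ := by
  obtain ⟨P, hP⟩ := exists_hasCoord (φ := φ) (v := ![1, r₁, p₁ * r₁])
    fun h0 => by simpa using congrFun h0 0
  obtain ⟨Q, hQ⟩ := exists_hasCoord (φ := φ) (v := ![1, r₂, p₂ * r₂])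
    fun h0 => by simpa using congrFun h0 0
  refine ⟨P, Q, (hl₁.mem_iff hP).2 ?_, (hm₁.mem_iff hP).2 ?_, (hn₁.mem_iff hP).2 ?_,
    (hl₂.mem_iff hQ).2 ?_, (hm₂.mem_iff hQ).2 ?_, (hn₂.mem_iff hQ).2 ?_⟩ <;>
    simp only [dotProduct, Fin.sum_univ_three, Matrix.cons_val]
  · ring
  · linear_combination h₁
  · ring
  · ring
  · linear_combination h₂
  · ring

/-! ### Six cevians touching a conic -/

/-- The dual of Carnot's theorem. -/
theorem touchOneConic_iff {l₁ l₂ m₁ m₂ n₁ n₂ : Projectivization.Subspace ℝ (Fin 3 → ℝ)}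
    {p₁ p₂ q₁ q₂ r₁ r₂ : ℝ} (hp₁ : p₁ ≠ 0) (hp₂ : p₂ ≠ 0) (hq₁ : q₁ ≠ 0)
    (hq₂ : q₂ ≠ 0) (hr₁ : r₁ ≠ 0) (hr₂ : r₂ ≠ 0) (hp : p₁ ≠ p₂) (hq : q₁ ≠ q₂) (hr : r₁ ≠ r₂)
    (hl₁ : HasLineCoord φ l₁ ![0, p₁, -1]) (hl₂ : HasLineCoord φ l₂ ![0, p₂, -1])
    (hm₁ : HasLineCoord φ m₁ ![-1, 0, q₁]) (hm₂ : HasLineCoord φ m₂ ![-1, 0, q₂])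
    (hn₁ : HasLineCoord φ n₁ ![r₁, -1, 0]) (hn₂ : HasLineCoord φ n₂ ![r₂, -1, 0]) :
    TouchOneConic {l₁, l₂, m₁, m₂, n₁, n₂} ↔ p₁ * p₂ * q₁ * q₂ * r₁ * r₂ = 1 := by
  have hl0 : ∀ p : ℝ, (![0, p, -1] : Fin 3 → ℝ) ≠ 0 := fun p h => by simpa using congrFun h 2
  have hm0 : ∀ p : ℝ, (![-1, 0, p] : Fin 3 → ℝ) ≠ 0 := fun p h => by simpa using congrFun h 0
  have hn0 : ∀ p : ℝ, (![p, -1, 0] : Fin 3 → ℝ) ≠ 0 := fun p h => by simpa using congrFun h 1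
  constructor
  · intro h
    obtain ⟨F, hF, hL⟩ := exists_dual_form φ h
    have scale : ∀ {p : ℝ} {u v : Fin 3 → ℝ}, p ≠ 0 → F u = 0 → u = p • v → F v = 0 := by
      rintro p _ v hp hu rfl
      simpa [QuadraticMap.map_smul, hp] using hu
    -- `[0, p, -1] = p[0, 1, -1/p]`, and cyclically, so the line coordinates have Carnot's shape
    -- with negative reciprocals. The six signs cancel and the product is `1 / D`.
    have hF' := (carnot (p₁ := -p₁⁻¹) (p₂ := -p₂⁻¹) (q₁ := -q₁⁻¹) (q₂ := -q₂⁻¹) (r₁ := -r₁⁻¹)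
      (r₂ := -r₂⁻¹) (by simpa using hp) (by simpa using hq) (by simpa using hr)).1
      ⟨F, hF, scale hp₁ (hL _ (by simp) _ (hl0 _) hl₁) (by simp [hp₁]),
        scale hp₂ (hL _ (by simp) _ (hl0 _) hl₂) (by simp [hp₂]),
        scale hq₁ (hL _ (by simp) _ (hm0 _) hm₁) (by simp [hq₁]),
        scale hq₂ (hL _ (by simp) _ (hm0 _) hm₂) (by simp [hq₂]),
        scale hr₁ (hL _ (by simp) _ (hn0 _) hn₁) (by simp [hr₁]),
        scale hr₂ (hL _ (by simp) _ (hn0 _) hn₂) (by simp [hr₂])⟩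
    field_simp at hF'
    linear_combination -hF'
  · intro hD
    -- A factor vanishes when `AA₁` is concurrent with one cevian from `B` and one from `C`. Since
    -- `D = 1`, the complementary three are then concurrent too, and the dual conic is the pair of
    -- these points.
    by_cases hd : (1 - p₁ * q₁ * r₁) * (1 - p₁ * q₁ * r₂) * (1 - p₁ * q₂ * r₁) *
      (1 - p₁ * q₂ * r₂) = 0
    · have hpair : ∀ {q q' r r' : ℝ}, 1 - p₁ * q * r = 0 →
          p₁ * q * r * (p₂ * q' * r') = p₁ * p₂ * q₁ * q₂ * r₁ * r₂ →
          p₁ * q * r = 1 ∧ p₂ * q' * r' = 1 := by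
        intro q q' r r' h h'
        have h1 : p₁ * q * r = 1 := by linear_combination -h
        rw [h1, one_mul, hD] at h'
        exact ⟨h1, h'⟩
      right
      simp only [mul_eq_zero] at hd
      rcases hd with ((h | h) | h) | h
      · obtain ⟨e₁, e₂⟩ := hpair (q' := q₂) (r' := r₂) h (by ring)
        obtain ⟨P, Q, h1, h2, h3, h4, h5, h6⟩ :=
          exists_concurrency_points hl₁ hl₂ hm₁ hm₂ hn₁ hn₂ e₁ e₂
        refine ⟨P, Q, ?_⟩
        rintro l (rfl | rfl | rfl | rfl | rfl | rfl) <;> tauto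
      · obtain ⟨e₁, e₂⟩ := hpair (q' := q₂) (r' := r₁) h (by ring)
        obtain ⟨P, Q, h1, h2, h3, h4, h5, h6⟩ :=
          exists_concurrency_points hl₁ hl₂ hm₁ hm₂ hn₂ hn₁ e₁ e₂
        refine ⟨P, Q, ?_⟩
        rintro l (rfl | rfl | rfl | rfl | rfl | rfl) <;> tauto
      · obtain ⟨e₁, e₂⟩ := hpair (q' := q₁) (r' := r₂) h (by ring)
        obtain ⟨P, Q, h1, h2, h3, h4, h5, h6⟩ :=
          exists_concurrency_points hl₁ hl₂ hm₂ hm₁ hn₁ hn₂ e₁ e₂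
        refine ⟨P, Q, ?_⟩
        rintro l (rfl | rfl | rfl | rfl | rfl | rfl) <;> tauto
      · obtain ⟨e₁, e₂⟩ := hpair (q' := q₁) (r' := r₁) h (by ring)
        obtain ⟨P, Q, h1, h2, h3, h4, h5, h6⟩ :=
          exists_concurrency_points hl₁ hl₂ hm₂ hm₁ hn₂ hn₁ e₁ e₂
        refine ⟨P, Q, ?_⟩
        rintro l (rfl | rfl | rfl | rfl | rfl | rfl) <;> tauto
    · have hdisc := dual_discriminant hD
      have hne : -(p₁ * p₂ ^ 3 * q₁ * q₂) * ((1 - p₁ * q₁ * r₁) * (1 - p₁ * q₁ * r₂) *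
          (1 - p₁ * q₂ * r₁) * (1 - p₁ * q₂ * r₂)) ≠ 0 :=
        mul_ne_zero (by simp [hp₁, hp₂, hq₁, hq₂]) hd
      -- This brings `hne` into the literal shape required by `ternary_nondegenerate`, so that
      -- unification reads off the coefficients of the dual conic. They are Vieta's formulas with `β
      -- = 1`.
      rw [← hdisc] at hne
      refine touchOneConic_of_dual φ (ternary_nondegenerate hne) ?_
      rintro l (rfl | rfl | rfl | rfl | rfl | rfl)
      · exact ⟨_, hl0 _, hl₁, by simp only [ternary_apply, Matrix.cons_val]; ring⟩
      · exact ⟨_, hl0 _, hl₂, by simp only [ternary_apply, Matrix.cons_val]; ring⟩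
      · exact ⟨_, hm0 _, hm₁, by simp only [ternary_apply, Matrix.cons_val]; ring⟩
      · exact ⟨_, hm0 _, hm₂, by simp only [ternary_apply, Matrix.cons_val]; ring⟩
      · exact ⟨_, hn0 _, hn₁, by
          simp only [ternary_apply, Matrix.cons_val]; linear_combination -hD⟩
      · exact ⟨_, hn0 _, hn₂, by
          simp only [ternary_apply, Matrix.cons_val]; linear_combination -hD⟩

end CevianConics

/-! ### Reduction of the four conditions to coordinates -/

theorem theorem1
    (A B C : Plane) (hABC : Projectivization.Independent ![A, B, C])
    (A₁ B₁ C₁ A₂ B₂ C₂ : Plane)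
    (hA₁ : IsFoot A₁ B C) (hB₁ : IsFoot B₁ C A) (hC₁ : IsFoot C₁ A B)
    (hA₂ : IsFoot A₂ B C) (hB₂ : IsFoot B₂ C A) (hC₂ : IsFoot C₂ A B)
    (hA : A₁ ≠ A₂) (hB : B₁ ≠ B₂) (hC : C₁ ≠ C₂)
    (X₁ Y₁ Z₁ X₂ Y₂ Z₂ U₁ V₁ W₁ : Plane)
    (hX₁ : IsMeet X₁ (line B B₁) (line C C₁))
    (hY₁ : IsMeet Y₁ (line A A₁) (line C C₁))
    (hZ₁ : IsMeet Z₁ (line A A₁) (line B B₁))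
    (hX₂ : IsMeet X₂ (line B B₂) (line C C₂))
    (hY₂ : IsMeet Y₂ (line A A₂) (line C C₂))
    (hZ₂ : IsMeet Z₂ (line A A₂) (line B B₂))
    (hU₁ : IsMeet U₁ (line B B₁) (line C C₂))
    (hV₁ : IsMeet V₁ (line C C₁) (line A A₂))
    (hW₁ : IsMeet W₁ (line A A₁) (line B B₂)) :
    List.TFAE [
      LieOnOneConic {A₁, A₂, B₁, B₂, C₁, C₂},
      TouchOneConic {line A A₁, line A A₂, line B B₁, line B B₂, line C C₁, line C C₂},
      ∃! O : Plane, O ∈ line A U₁ ∧ O ∈ line B V₁ ∧ O ∈ line C W₁] ∧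
    (LieOnOneConic {A₁, A₂, B₁, B₂, C₁, C₂} →
      LieOnOneConic {X₁, X₂, Y₁, Y₂, Z₁, Z₂}) ∧
    (((X₁ = Y₁ ∧ Y₁ = Z₁) ↔ (X₂ = Y₂ ∧ Y₂ = Z₂)) →
      List.TFAE [
        LieOnOneConic {A₁, A₂, B₁, B₂, C₁, C₂},
        LieOnOneConic {X₁, X₂, Y₁, Y₂, Z₁, Z₂},
        TouchOneConic {line A A₁, line A A₂, line B B₁, line B B₂, line C C₁, line C C₂},
        ∃! O : Plane, O ∈ line A U₁ ∧ O ∈ line B V₁ ∧ O ∈ line C W₁]) := by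
  obtain ⟨φ, hφA, hφB, hφC⟩ := exists_coordinates hABC
  obtain ⟨p₁, a₁, hp₁, ha₁, eA₁⟩ := hA₁.exists_coord
  obtain ⟨q₁, b₁, hq₁, hb₁, eB₁⟩ := hB₁.exists_coord
  obtain ⟨r₁, c₁, hr₁, hc₁, eC₁⟩ := hC₁.exists_coord
  obtain ⟨p₂, a₂, hp₂, ha₂, eA₂⟩ := hA₂.exists_coord
  obtain ⟨q₂, b₂, hq₂, hb₂, eB₂⟩ := hB₂.exists_coord
  obtain ⟨r₂, c₂, hr₂, hc₂, eC₂⟩ := hC₂.exists_coord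
  have hp : p₁ ≠ p₂ := coord_ne ha₂ eA₁ eA₂ hA
  have hq : q₁ ≠ q₂ := coord_ne hb₂ eB₁ eB₂ hB
  have hr : r₁ ≠ r₂ := coord_ne hc₂ eC₁ eC₂ hC
  have cA : HasCoord φ A ![1, 0, 0] := ⟨1, one_ne_zero, by rw [hφA, one_smul]⟩
  have cB : HasCoord φ B ![0, 1, 0] := ⟨1, one_ne_zero, by rw [hφB, one_smul]⟩
  have cC : HasCoord φ C ![0, 0, 1] := ⟨1, one_ne_zero, by rw [hφC, one_smul]⟩
  have cA₁ : HasCoord φ A₁ ![0, 1, p₁] := ⟨a₁, ha₁, by simp [eA₁, hφB, hφC]⟩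
  have cA₂ : HasCoord φ A₂ ![0, 1, p₂] := ⟨a₂, ha₂, by simp [eA₂, hφB, hφC]⟩
  have cB₁ : HasCoord φ B₁ ![q₁, 0, 1] := ⟨b₁, hb₁, by simp [eB₁, hφC, hφA]⟩
  have cB₂ : HasCoord φ B₂ ![q₂, 0, 1] := ⟨b₂, hb₂, by simp [eB₂, hφC, hφA]⟩
  have cC₁ : HasCoord φ C₁ ![1, r₁, 0] := ⟨c₁, hc₁, by simp [eC₁, hφA, hφB]⟩
  have cC₂ : HasCoord φ C₂ ![1, r₂, 0] := ⟨c₂, hc₂, by simp [eC₂, hφA, hφB]⟩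
  have lA₁ := hasLineCoord_fst cA cA₁ one_ne_zero
  have lA₂ := hasLineCoord_fst cA cA₂ one_ne_zero
  have lB₁ := hasLineCoord_snd cB cB₁ one_ne_zero
  have lB₂ := hasLineCoord_snd cB cB₂ one_ne_zero
  have lC₁ := hasLineCoord_thd cC cC₁ one_ne_zero
  have lC₂ := hasLineCoord_thd cC cC₂ one_ne_zero
  have cX₁ := hX₁.hasCoord_snd_thd lB₁ lC₁
  have cX₂ := hX₂.hasCoord_snd_thd lB₂ lC₂
  have cY₁ := hY₁.hasCoord_fst_thd lA₁ lC₁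
  have cY₂ := hY₂.hasCoord_fst_thd lA₂ lC₂
  have cZ₁ := hZ₁.hasCoord_fst_snd lA₁ lB₁
  have cZ₂ := hZ₂.hasCoord_fst_snd lA₂ lB₂
  have cU := hU₁.hasCoord_snd_thd lB₁ lC₂
  have cV := IsMeet.hasCoord_fst_thd hV₁.symm lA₂ lC₁
  have cW := hW₁.hasCoord_fst_snd lA₁ lB₂
  have h1 : LieOnOneConic {A₁, A₂, B₁, B₂, C₁, C₂} ↔ p₁ * p₂ * q₁ * q₂ * r₁ * r₂ = 1 :=
    (lieOnOneConic_six_iff cA₁ cA₂ cB₁ cB₂ cC₁ cC₂).trans (carnot hp hq hr)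
  have h2 := lieOnOneConic_six_iff cX₁ cX₂ cY₁ cY₂ cZ₁ cZ₂
  have h3 := touchOneConic_iff hp₁ hp₂ hq₁ hq₂ hr₁ hr₂ hp hq hr lA₁ lA₂ lB₁ lB₂ lC₁ lC₂
  have h4 : (∃! O : Plane, O ∈ line A U₁ ∧ O ∈ line B V₁ ∧ O ∈ line C W₁) ↔
      p₁ * p₂ * q₁ * q₂ * r₁ * r₂ = 1 := by
    rw [existsUnique_mem_iff
      (hasLineCoord_fst cA cU (mul_ne_zero hq₁ hr₂))
      (hasLineCoord_snd cB cV (mul_ne_zero hp₂ hr₁))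
      (hasLineCoord_thd cC cW (mul_ne_zero hq₂ hp₁))]
    rw [show q₁ * r₂ * (p₂ * r₁) * (q₂ * p₁) = p₁ * p₂ * q₁ * q₂ * r₁ * r₂ by ring]
  have h12 : LieOnOneConic {A₁, A₂, B₁, B₂, C₁, C₂} →
      LieOnOneConic {X₁, X₂, Y₁, Y₂, Z₁, Z₂} := fun h =>
    h2.2 (exists_form_cevian_triangles hp₁ hp₂ hq₁ hq₂ hr₁ hr₂ (h1.1 h))
  refine ⟨?_, h12, fun hconc => ?_⟩
  · tfae_have 1 ↔ 2 := h1.trans h3.symm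
    tfae_have 1 ↔ 3 := h1.trans h4.symm
    tfae_finish
  · tfae_have 1 → 2 := h12
    tfae_have 2 → 1 := by
      intro h
      rw [h1]
      rw [ceva cX₁ cY₁ cZ₁, ceva cX₂ cY₂ cZ₂] at hconc
      -- If both triples are concurrent, `D = 1` follows from the two Ceva relations and the conic
      -- plays no role.
      by_cases hk : p₁ * q₁ * r₁ = 1
      · linear_combination p₂ * q₂ * r₂ * hk + hconc.1 hk
      · obtain ⟨F, hF, x₁, x₂, y₁, y₂, z₁, z₂⟩ := h2.1 h
        exact carnot_of_form_cevian_triangles hp₁ hp₂ hq₁ hq₂ hr₁ hr₂ hp hq hr hk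
          (mt hconc.2 hk) hF x₁ x₂ y₁ y₂ z₁ z₂
    tfae_have 1 ↔ 3 := h1.trans h3.symm
    tfae_have 1 ↔ 4 := h1.trans h4.symm
    tfae_finish
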